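/- Let $H=\{z\in\mathbf C : \operatorname{Im} z>0\}$ be the upper half-plane with the hyperbolic metric $ds^2=(dx^2+dy^2)/y^2$ and hyperbolic distance $d$, on which $PSL(2,\mathbf R)$ acts by Möbius transformations. Let $\Gamma_\infty\subset PSL(2,\mathbf R)$ be the cyclic group generated by $z\mapsto z+1$. Consider all Fuchsian groups $\Gamma$ (discrete subgroups of $PSL(2,\mathbf R)$) that act freely on $H$, so that $\Gamma$ uniformizes the hyperbolic surface $H/\Gamma$, and that are normalized so that $\Gamma_\infty\subset\Gamma$ is the full stabilizer of $\infty$ in $\Gamma$ (so that $\infty$ corresponds to a puncture of $H/\Gamma$). For such $\Gamma$, for $z\in H$ and for a class $[\delta]\in\Gamma_\infty\backslash\Gamma$, let $\hat\delta=\hat\delta(z,[\delta])$ be the canonical representative, i.e. the unique element of $[\delta]$ with $-\tfrac12\le\operatorname{Re}\hat\delta z<\tfrac12$, and put $$\Pi_\Gamma(z,t)=\sharp\{[\delta]\in\Gamma_\infty\backslash\Gamma \;:\; d(i,\hat\delta z)\le t\}.$$ Proposition 2.1. There is an absolute constant $U$ such that for every such group $\Gamma$, every $z\in H$ with $\operatorname{Im}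 z<1$ and every $t\ge 0$, the number $\Pi_\Gamma(z,t)$ is finite and $$\Pi_\Gamma(z,t)\le U e^{t}.$$ In particular, the same $U$ serves for all the groups $\Gamma_l$, normalized in this way, that uniformize the members $S_l$ of any degenerating family of punctured hyperbolic surfaces. -/

import Mathlib

open UpperHalfPlane
open scoped MatrixGroups

namespace OrbitCount

/-- `PSL(2, ℝ)` acts on the upper half-plane by Möbius transformations
(restriction of Mathlib's action of `PGL(2, ℝ)`). -/
noncomputable instance pslAction : MulAction PSL(2, ℝ) ℍ :=
  MulAction.compHom ℍ (Matrix.ProjectiveSpecialLinearGroup.toPGL (n := Fin 2) (R := ℝ))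

/-- The class of a matrix acts as the matrix does, `z ↦ (a z + b) / (c z + d)`. -/
theorem mk_smul (g : SL(2, ℝ)) (z : ℍ) :
    (QuotientGroup.mk g : PSL(2, ℝ)) • z = g • z := rfl

/-- The matrix `(1, 1; 0, 1)`. -/
def translationMatrix : SL(2, ℝ) := ⟨!![1, 1; 0, 1], by simp [Matrix.det_fin_two]⟩

/-- The parabolic element `z ↦ z + 1` of `PSL(2, ℝ)`. -/
def translation : PSL(2, ℝ) := QuotientGroup.mk translationMatrix

theorem translation_smul (z : ℍ) : translation • z = (1 : ℝ) +ᵥ z := by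
  rw [translation, mk_smul]
  ext
  rw [coe_specialLinearGroup_apply]
  simp [translationMatrix, add_comm]

/-- `Γ_∞`, the cyclic group generated by `z ↦ z + 1`. -/
def gammaInfty : Subgroup PSL(2, ℝ) := Subgroup.zpowers translation

/-- The subgroup of all elements of `PSL(2, ℝ)` that fix the boundary point `∞`. -/
noncomputable def stabilizerInfty : Subgroup PSL(2, ℝ) :=
  ((MulAction.stabilizer (GL (Fin 2) ℝ) (OnePoint.infty : OnePoint ℝ)).comap
    (Matrix.SpecialLinearGroup.toGL (n := Fin 2) (R := ℝ))).map
    (QuotientGroup.mk' (Subgroup.center SL(2, ℝ)))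

/-- `Γ` is a Fuchsian group that uniformizes a hyperbolic surface `ℍ / Γ` with a puncture,
normalized so that the puncture corresponds to `∞` and the stabilizer of `∞` in `Γ` is
generated by `z ↦ z + 1`. -/
structure IsNormalizedFuchsian (Γ : Subgroup PSL(2, ℝ)) : Prop where
  discrete : DiscreteTopology Γ
  free : ∀ γ ∈ Γ, ∀ z : ℍ, γ • z = z → γ = 1
  cusp : Γ ⊓ stabilizerInfty = gammaInfty

/-- The coset space `Γ_∞ \ Γ`, whose elements are the classes `Γ_∞ δ`. -/
abbrev CuspCosets (Γ : Subgroup PSL(2, ℝ)) : Type :=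
  Quotient (QuotientGroup.rightRel (gammaInfty.subgroupOf Γ))

/-- `δ` is the canonical representative, with respect to `z`, of the class `q` in `Γ_∞ \ Γ`:
it lies in `q` and `-1/2 ≤ Re (δ z) < 1/2`. -/
def IsCanonicalRep (Γ : Subgroup PSL(2, ℝ)) (z : ℍ) (q : CuspCosets Γ) (δ : Γ) : Prop :=
  Quotient.mk (QuotientGroup.rightRel (gammaInfty.subgroupOf Γ)) δ = q ∧
    -(1 / 2) ≤ ((δ : PSL(2, ℝ)) • z).re ∧ ((δ : PSL(2, ℝ)) • z).re < 1 / 2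

theorem translation_zpow_smul (n : ℤ) (z : ℍ) : translation ^ n • z = (n : ℝ) +ᵥ z := by
  have hnat : ∀ (n : ℕ) (z : ℍ), translation ^ n • z = (n : ℝ) +ᵥ z := by
    intro n
    induction n with
    | zero => intro z; simp
    | succ n ih =>
      intro z
      rw [pow_succ, mul_smul, ih, translation_smul, vadd_vadd]
      push_cast
      rfl
  obtain ⟨m, rfl | rfl⟩ := n.eq_nat_or_neg
  · simpa using hnat m z
  · rw [zpow_neg, inv_smul_eq_iff, zpow_natCast, hnat, vadd_vadd]
    simp

/-- Canonical representatives exist and are unique. -/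
theorem existsUnique_isCanonicalRep {Γ : Subgroup PSL(2, ℝ)} (hΓ : gammaInfty ≤ Γ)
    (z : ℍ) (q : CuspCosets Γ) : ∃! δ : Γ, IsCanonicalRep Γ z q δ := by
  obtain ⟨δ₀, rfl⟩ := Quotient.exists_rep q
  have key : ∀ δ : Γ, Quotient.mk (QuotientGroup.rightRel (gammaInfty.subgroupOf Γ)) δ =
      Quotient.mk (QuotientGroup.rightRel (gammaInfty.subgroupOf Γ)) δ₀ ↔
      ∃ n : ℤ, (δ : PSL(2, ℝ)) = translation ^ n * δ₀ := by
    intro δ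
    rw [eq_comm, Quotient.eq, QuotientGroup.rightRel_apply, Subgroup.mem_subgroupOf, gammaInfty,
      Subgroup.mem_zpowers_iff]
    constructor
    · rintro ⟨n, hn⟩
      exact ⟨n, by rw [hn]; simp⟩
    · rintro ⟨n, hn⟩
      exact ⟨n, by simp [hn]⟩
  set x : ℝ := ((δ₀ : PSL(2, ℝ)) • z).re with hx
  have hre : ∀ n : ℤ, ((translation ^ n * (δ₀ : PSL(2, ℝ))) • z).re = n + x := by
    intro n
    rw [mul_smul, translation_zpow_smul, vadd_re]
  have hmem : ∀ n : ℤ, translation ^ n ∈ Γ := fun n => hΓ (zpow_mem (Subgroup.mem_zpowers _) n)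
  refine ⟨⟨translation ^ (-⌊x + 1 / 2⌋) * δ₀, Γ.mul_mem (hmem _) δ₀.2⟩, ⟨?_, ?_, ?_⟩, ?_⟩
  · exact (key _).2 ⟨_, rfl⟩
  · change -(1 / 2) ≤ ((translation ^ (-⌊x + 1 / 2⌋) * (δ₀ : PSL(2, ℝ))) • z).re
    rw [hre]; push_cast; linarith [Int.floor_le (x + 1 / 2)]
  · change ((translation ^ (-⌊x + 1 / 2⌋) * (δ₀ : PSL(2, ℝ))) • z).re < 1 / 2
    rw [hre]; push_cast; linarith [Int.lt_floor_add_one (x + 1 / 2)]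
  · rintro δ ⟨h1, h2, h3⟩
    obtain ⟨n, hn⟩ := (key δ).1 h1
    rw [hn, hre] at h2 h3
    have : ⌊x + 1 / 2⌋ = -n := by
      rw [Int.floor_eq_iff]
      push_cast
      constructor <;> linarith
    apply Subtype.ext
    have h4 : n = -⌊x + 1 / 2⌋ := by rw [this]; simp
    rw [hn, h4]

/-- The set of classes in `Γ_∞ \ Γ` whose canonical representative `δ` satisfies
`d(i, δ z) ≤ t`, where `d` is the hyperbolic distance. -/
def orbitCosets (Γ : Subgroup PSL(2, ℝ)) (z : ℍ) (t : ℝ) : Set (CuspCosets Γ) :=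
  {q | ∃ δ : Γ, IsCanonicalRep Γ z q δ ∧ dist UpperHalfPlane.I ((δ : PSL(2, ℝ)) • z) ≤ t}

/-- The counting function `Π(z, t)`. It is `0` by convention if the set is infinite. -/
noncomputable def orbitCount (Γ : Subgroup PSL(2, ℝ)) (z : ℍ) (t : ℝ) : ℕ :=
  (orbitCosets Γ z t).ncard

end OrbitCount

namespace OrbitCount

open Filter Topology

/-! Let `(c, d)` be the bottom row of a representative of a class. If d(i, δz) ≤ t then Im δz ≥
e^{-t}, so cz + d, viewed as a plane vector, lies in the disc of squared radius Im z · e^t. For two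
distinct classes the wedge of these vectors is, up to sign, Im z times the lower-left entry of a
quotient of the two elements. That entry is nonzero because the quotient does not fix ∞, so by
Shimizu's lemma it is at least 1 in absolute value, and the wedge is at least Im z. The count is
then planar: wedges bounded below force separated directions. Only the ratio e^t of the two bounds
enters, so the constant depends neither on Γ nor on z. -/

/-- Vectors of length at most `√(m R)` in the cone `|y| ≤ |x|` with pairwise wedge products at
least `m` have `1 / R`-separated slopes. -/
theorem ncard_le_of_wedge_of_cone {ι : Type*} {s : Set ι} {x y : ι → ℝ} {m R : ℝ} (hm : 0 < m)
    (hR : 0 < R) (hcone : ∀ i ∈ s, |y i| ≤ |x i|) (hb : ∀ i ∈ s, x i ^ 2 + y i ^ 2 ≤ m * R)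
    (hw : ∀ i ∈ s, ∀ j ∈ s, i ≠ j → m ≤ |x i * y j - x j * y i|) :
    s.Finite ∧ (s.ncard : ℝ) ≤ 2 * R + 2 := by
  set f : ι → ℤ := fun i => ⌊y i / x i * R⌋
  set I : Finset ℤ := Finset.Icc ⌊-R⌋ ⌊R⌋
  have hmaps : Set.MapsTo f s I := by
    intro i hi
    have h1 : |y i / x i| ≤ 1 := by
      rw [abs_div]
      exact div_le_one_of_le₀ (hcone i hi) (abs_nonneg _)
    obtain ⟨h2, h3⟩ := abs_le.1 h1
    simp only [I, Finset.coe_Icc, Set.mem_Icc]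
    exact ⟨Int.floor_le_floor (by nlinarith), Int.floor_le_floor (by nlinarith)⟩
  have hinj : Set.InjOn f s := by
    intro i hi j hj hij
    by_contra hne
    have hwij := hw i hi j hj hne
    have hxi : x i ≠ 0 := by
      intro h0
      have : y i = 0 := by simpa [h0] using hcone i hi
      simp [h0, this] at hwij
      linarith
    have hxj : x j ≠ 0 := by
      intro h0
      have : y j = 0 := by simpa [h0] using hcone j hj
      simp [h0, this] at hwij
      linarith
    -- Equal floors would give |wedge| · R < |x i * x j| ≤ m R, contradicting |wedge| ≥ m.
    have h1 : |y i / x i * R - y j / x j * R| < 1 := Int.abs_sub_lt_one_of_floor_eq_floor hij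
    have h2 : y i / x i * R - y j / x j * R
        = -((x i * y j - x j * y i) * R / (x i * x j)) := by
      field_simp
      ring
    rw [h2, abs_neg, abs_div, abs_mul, abs_of_pos hR, div_lt_one (by positivity)] at h1
    have h3 : |x i * x j| ≤ m * R := by
      rw [abs_le]
      constructor <;>
        nlinarith [hb i hi, hb j hj, sq_nonneg (x i + x j), sq_nonneg (x i - x j),
          sq_nonneg (y i), sq_nonneg (y j)]
    nlinarith
  refine ⟨Set.Finite.of_injOn hmaps hinj I.finite_toSet, ?_⟩
  have hle := Set.ncard_le_ncard_of_injOn f hmaps hinj I.finite_toSet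
  rw [Set.ncard_coe_finset, Int.card_Icc] at hle
  have h4 : ⌊-R⌋ ≤ ⌊R⌋ := Int.floor_le_floor (by linarith)
  have h5 : (s.ncard : ℤ) ≤ ⌊R⌋ + 1 - ⌊-R⌋ := by omega
  have h6 : (s.ncard : ℝ) ≤ ⌊R⌋ + 1 - ⌊-R⌋ := by exact_mod_cast h5
  linarith [Int.floor_le R, Int.lt_floor_add_one (-R)]

/-- A set of plane vectors in a disc of radius `√(m R)` with pairwise wedge products at least `m`
has at most `4 R + 4` elements. -/
theorem ncard_le_of_wedge {ι : Type*} {s : Set ι} {x y : ι → ℝ} {m R : ℝ} (hm : 0 < m)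
    (hR : 0 < R) (hb : ∀ i ∈ s, x i ^ 2 + y i ^ 2 ≤ m * R)
    (hw : ∀ i ∈ s, ∀ j ∈ s, i ≠ j → m ≤ |x i * y j - x j * y i|) :
    s.Finite ∧ (s.ncard : ℝ) ≤ 4 * R + 4 := by
  obtain ⟨hf₁, hc₁⟩ := ncard_le_of_wedge_of_cone (s := s ∩ {i | |y i| ≤ |x i|}) hm hR
    (fun i hi => hi.2) (fun i hi => hb i hi.1) (fun i hi j hj => hw i hi.1 j hj.1)
  obtain ⟨hf₂, hc₂⟩ := ncard_le_of_wedge_of_cone (s := s ∩ {i | |x i| ≤ |y i|}) (x := y) (y := x)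
    hm hR (fun i hi => hi.2) (fun i hi => by linarith [hb i hi.1])
    (fun i hi j hj hij => by
      rw [abs_sub_comm, mul_comm (y j), mul_comm (y i)]
      exact hw i hi.1 j hj.1 hij)
  have hs : s = (s ∩ {i | |y i| ≤ |x i|}) ∪ (s ∩ {i | |x i| ≤ |y i|}) := by
    rw [← Set.inter_union_distrib_left, eq_comm, Set.inter_eq_left]
    exact fun i _ => le_total |y i| |x i|
  refine ⟨by rw [hs]; exact hf₁.union hf₂, ?_⟩
  have h : (s.ncard : ℝ) ≤ (s ∩ {i | |y i| ≤ |x i|}).ncard + (s ∩ {i | |x i| ≤ |y i|}).ncard := by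
    have := Set.ncard_union_le (s ∩ {i | |y i| ≤ |x i|}) (s ∩ {i | |x i| ≤ |y i|})
    rw [← hs] at this
    exact_mod_cast this
  linarith

/-! ### Shimizu's lemma -/

/-- The sequence `A, A T A⁻¹, …` of iterated conjugates of the translation `T` in Shimizu's
lemma. -/
def shimizuSeq (A : SL(2, ℝ)) : ℕ → SL(2, ℝ)
  | 0 => A
  | n + 1 => shimizuSeq A n * translationMatrix * (shimizuSeq A n)⁻¹

theorem conj_translationMatrix (A : SL(2, ℝ)) :
    ((A * translationMatrix * A⁻¹ : SL(2, ℝ)) : Matrix (Fin 2) (Fin 2) ℝ) =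
      !![1 - A 0 0 * A 1 0, A 0 0 ^ 2; -A 1 0 ^ 2, 1 + A 0 0 * A 1 0] := by
  have hdet := A.det_coe
  rw [Matrix.det_fin_two] at hdet
  have hT : (translationMatrix : Matrix (Fin 2) (Fin 2) ℝ) = !![1, 1; 0, 1] := rfl
  rw [Matrix.SpecialLinearGroup.coe_mul, Matrix.SpecialLinearGroup.coe_mul,
    Matrix.SpecialLinearGroup.coe_inv, hT]
  ext i j
  fin_cases i <;> fin_cases j <;>
    simp [Matrix.adjugate_fin_two, Matrix.mul_apply, Fin.sum_univ_two] <;> linarith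

theorem coe_shimizuSeq_succ (A : SL(2, ℝ)) (n : ℕ) :
    (shimizuSeq A (n + 1) : Matrix (Fin 2) (Fin 2) ℝ) =
      !![1 - shimizuSeq A n 0 0 * shimizuSeq A n 1 0, shimizuSeq A n 0 0 ^ 2;
        -shimizuSeq A n 1 0 ^ 2, 1 + shimizuSeq A n 0 0 * shimizuSeq A n 1 0] :=
  conj_translationMatrix _

/-- Each conjugation squares the lower-left entry up to sign: if nonzero it stays nonzero, yet it
tends to 0 when it starts below 1 in absolute value. -/
theorem abs_shimizuSeq_one_zero (A : SL(2, ℝ)) (n : ℕ) :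
    |shimizuSeq A n 1 0| = |A 1 0| ^ 2 ^ n := by
  induction n with
  | zero => simp [shimizuSeq]
  | succ n ih =>
    have h : shimizuSeq A (n + 1) 1 0 = -(shimizuSeq A n 1 0) ^ 2 := by
      simp [coe_shimizuSeq_succ]
    rw [h, abs_neg, abs_pow, ih, ← pow_mul, ← pow_succ]

/-- With `c n` → 0 and `a n` bounded, the recursion `a (n + 1) = 1 - a n * c n` gives `a n` → 1; all
entries of the next matrix are polynomials in these two. -/
theorem tendsto_shimizuSeq {A : SL(2, ℝ)} (hA : |A 1 0| < 1) :
    Tendsto (shimizuSeq A) atTop (𝓝 translationMatrix) := by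
  set a : ℕ → ℝ := fun n => shimizuSeq A n 0 0 with ha
  set c : ℕ → ℝ := fun n => shimizuSeq A n 1 0 with hc
  have habs : ∀ n, |c n| = |A 1 0| ^ 2 ^ n := abs_shimizuSeq_one_zero A
  have hc_le : ∀ n, |c n| ≤ |A 1 0| := by
    intro n
    rw [habs]
    exact pow_le_of_le_one (abs_nonneg _) hA.le (by positivity)
  have hc0 : Tendsto c atTop (𝓝 0) := by
    rw [tendsto_zero_iff_abs_tendsto_zero]
    refine ((tendsto_pow_atTop_nhds_zero_of_lt_one (abs_nonneg _) hA).comp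
      (tendsto_pow_atTop_atTop_of_one_lt (one_lt_two : 1 < (2 : ℕ)))).congr fun n => ?_
    exact (habs n).symm
  have ha_succ : ∀ n, a (n + 1) = 1 - a n * c n := by
    intro n
    simp [ha, hc, coe_shimizuSeq_succ]
  obtain ⟨M, hM⟩ : ∃ M, ∀ n, |a n| ≤ M := by
    -- The second term is the fixed point of M ↦ 1 + M |A 1 0|, so the bound survives the recursion.
    refine ⟨max |A 0 0| (1 / (1 - |A 1 0|)), fun n => ?_⟩
    set M := max |A 0 0| (1 / (1 - |A 1 0|))
    have hM1 : 1 ≤ M * (1 - |A 1 0|) := by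
      rw [← div_le_iff₀ (by linarith)]
      exact le_max_right _ _
    induction n with
    | zero => exact le_max_left _ _
    | succ n ih =>
      have h1 : |a (n + 1)| ≤ 1 + |a n| * |c n| := by
        rw [ha_succ, ← abs_mul]
        simpa using abs_sub (1 : ℝ) (a n * c n)
      have h2 : |a n| * |c n| ≤ M * |A 1 0| :=
        mul_le_mul ih (hc_le n) (abs_nonneg _) ((abs_nonneg _).trans ih)
      linarith
  have hac : Tendsto (fun n => a n * c n) atTop (𝓝 0) :=
    bdd_le_mul_tendsto_zero' M (Eventually.of_forall hM) hc0
  have ha1 : Tendsto a atTop (𝓝 1) := by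
    rw [← tendsto_add_atTop_iff_nat 1]
    simpa [ha_succ] using hac.const_sub 1
  rw [← tendsto_add_atTop_iff_nat 1]
  refine tendsto_subtype_rng.2 (tendsto_pi_nhds.2 fun i => tendsto_pi_nhds.2 fun j => ?_)
  simp only [coe_shimizuSeq_succ]
  fin_cases i <;> fin_cases j
  · simpa [translationMatrix] using hac.const_sub 1
  · simpa [translationMatrix] using ha1.pow 2
  · simpa [translationMatrix] using (hc0.pow 2).neg
  · simpa [translationMatrix] using hac.const_add 1

theorem one_zero_eq_zero_of_mk_eq_translation {B : SL(2, ℝ)}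
    (hB : (QuotientGroup.mk B : PSL(2, ℝ)) = translation) : B 1 0 = 0 := by
  rw [translation, eq_comm, QuotientGroup.eq,
    Matrix.SpecialLinearGroup.mem_center_iff] at hB
  obtain ⟨r, -, hr⟩ := hB
  have hB' : (B : Matrix (Fin 2) (Fin 2) ℝ) =
      translationMatrix * Matrix.scalar (Fin 2) r := by
    rw [hr, ← Matrix.SpecialLinearGroup.coe_mul, mul_inv_cancel_left]
  rw [hB']
  simp [translationMatrix, Matrix.mul_apply, Fin.sum_univ_two]

/-- **Shimizu's lemma**. -/
theorem one_le_abs_of_mk_mem {Γ : Subgroup PSL(2, ℝ)} [DiscreteTopology Γ]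
    (hT : translation ∈ Γ) {A : SL(2, ℝ)} (hA : (QuotientGroup.mk A : PSL(2, ℝ)) ∈ Γ)
    (h0 : A 1 0 ≠ 0) : 1 ≤ |A 1 0| := by
  by_contra! hlt
  have hmem : ∀ n, (QuotientGroup.mk (shimizuSeq A n) : PSL(2, ℝ)) ∈ Γ := by
    intro n
    induction n with
    | zero => exact hA
    | succ n ih => exact Γ.mul_mem (Γ.mul_mem ih hT) (Γ.inv_mem ih)
  have hlim : Tendsto (fun n => (⟨_, hmem n⟩ : Γ)) atTop (𝓝 ⟨translation, hT⟩) :=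
    tendsto_subtype_rng.2
      ((continuous_quotient_mk'.tendsto translationMatrix).comp (tendsto_shimizuSeq hlt))
  -- In a discrete group a convergent sequence is eventually equal to its limit, here a translation,
  -- whose lower-left entry vanishes.
  rw [nhds_discrete, tendsto_pure] at hlim
  obtain ⟨n, hn⟩ := hlim.exists
  have h1 := one_zero_eq_zero_of_mk_eq_translation (congrArg Subtype.val hn)
  have h2 := abs_shimizuSeq_one_zero A n
  rw [h1, abs_zero] at h2
  exact pow_ne_zero _ (abs_ne_zero.2 h0) h2.symm

theorem mk_mem_stabilizerInfty {A : SL(2, ℝ)} (hA : A 1 0 = 0) :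
    (QuotientGroup.mk A : PSL(2, ℝ)) ∈ stabilizerInfty := by
  refine ⟨A, ?_, rfl⟩
  simpa [OnePoint.smul_infty_eq_self_iff] using hA

/-! ### Bottom rows of the cosets and the count -/

namespace IsNormalizedFuchsian

variable {Γ : Subgroup PSL(2, ℝ)}

theorem translation_mem (hΓ : IsNormalizedFuchsian Γ) : translation ∈ Γ := by
  have h : translation ∈ Γ ⊓ stabilizerInfty := by
    rw [hΓ.cusp]
    exact Subgroup.mem_zpowers _
  exact h.1

/-- The bottom rows of representatives of distinct cosets have wedge product at least `1`. -/
theorem one_le_abs_wedge (hΓ : IsNormalizedFuchsian Γ) {A B : SL(2, ℝ)}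
    (hA : (QuotientGroup.mk A : PSL(2, ℝ)) ∈ Γ) (hB : (QuotientGroup.mk B : PSL(2, ℝ)) ∈ Γ)
    (hne : Quotient.mk (QuotientGroup.rightRel (gammaInfty.subgroupOf Γ)) ⟨_, hA⟩ ≠
      Quotient.mk (QuotientGroup.rightRel (gammaInfty.subgroupOf Γ)) ⟨_, hB⟩) :
    1 ≤ |A 1 1 * B 1 0 - B 1 1 * A 1 0| := by
  have hmem : (QuotientGroup.mk (B * A⁻¹) : PSL(2, ℝ)) ∈ Γ := Γ.mul_mem hB (Γ.inv_mem hA)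
  have hentry : (B * A⁻¹) 1 0 = A 1 1 * B 1 0 - B 1 1 * A 1 0 := by
    simp [Matrix.SpecialLinearGroup.coe_inv, Matrix.adjugate_fin_two, Matrix.mul_apply,
      Fin.sum_univ_two]
    ring
  rw [← hentry]
  have := hΓ.discrete
  refine one_le_abs_of_mk_mem hΓ.translation_mem hmem fun h0 => hne ?_
  rw [Quotient.eq, QuotientGroup.rightRel_apply, Subgroup.mem_subgroupOf, ← hΓ.cusp]
  exact ⟨hmem, mk_mem_stabilizerInfty h0⟩

end IsNormalizedFuchsian

/-- Hyperbolic distance dominates the difference of log Im, and Im(Az) = Im z / |cz + d|². -/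
theorem normSq_denom_le_of_dist_le {A : SL(2, ℝ)} {z : ℍ} {t : ℝ}
    (h : dist UpperHalfPlane.I (A • z) ≤ t) :
    (A 1 0 * z.re + A 1 1) ^ 2 + (A 1 0 * z.im) ^ 2 ≤ z.im * Real.exp t := by
  have h1 := (UpperHalfPlane.dist_log_im_le UpperHalfPlane.I (A • z)).trans h
  rw [UpperHalfPlane.I_im, Real.log_one, Real.dist_eq, zero_sub, abs_neg] at h1
  have h2 : Real.exp (-t) ≤ (A • z).im := by
    rw [← Real.le_log_iff_exp_le (A • z).im_pos]
    exact (abs_le.1 h1).1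
  have h3 : Complex.normSq (UpperHalfPlane.denom A z)
      = (A 1 0 * z.re + A 1 1) ^ 2 + (A 1 0 * z.im) ^ 2 := by
    simp [UpperHalfPlane.denom, Complex.normSq_apply]
    ring
  have hpos := UpperHalfPlane.normSq_denom_pos (A : GL (Fin 2) ℝ) z.im_ne_zero
  have h4 : (A • z).im = z.im / Complex.normSq (UpperHalfPlane.denom A z) := by
    have h5 : A • z = (A : GL (Fin 2) ℝ) • z := rfl
    rw [h5, UpperHalfPlane.im_smul_eq_div_normSq]
    simp
  rw [h4, le_div_iff₀ hpos, Real.exp_neg, inv_mul_le_iff₀ (Real.exp_pos t)] at h2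
  linarith

end OrbitCount

open OrbitCount in
theorem proposition2p1 :
    ∃ U : ℝ, ∀ Γ : Subgroup PSL(2, ℝ), OrbitCount.IsNormalizedFuchsian Γ →
      ∀ z : ℍ, z.im < 1 → ∀ t : ℝ, 0 ≤ t →
        (OrbitCount.orbitCosets Γ z t).Finite ∧
          (OrbitCount.orbitCount Γ z t : ℝ) ≤ U * Real.exp t := by
  -- The planar count gives 4 e^t + 4, and 4 ≤ 4 e^t since t ≥ 0.
  refine ⟨8, fun Γ hΓ z _ t ht => ?_⟩
  have hrep : ∀ q : CuspCosets Γ, ∃ A : SL(2, ℝ), q ∈ orbitCosets Γ z t →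
      dist UpperHalfPlane.I (A • z) ≤ t ∧ ∃ hA : (QuotientGroup.mk A : PSL(2, ℝ)) ∈ Γ,
        Quotient.mk (QuotientGroup.rightRel (gammaInfty.subgroupOf Γ)) ⟨_, hA⟩ = q := by
    intro q
    by_cases hq : q ∈ orbitCosets Γ z t
    · obtain ⟨⟨δ, hδ⟩, hcan, hdist⟩ := hq
      obtain ⟨A, rfl⟩ := QuotientGroup.mk_surjective δ
      exact ⟨A, fun _ => ⟨hdist, hδ, hcan.1⟩⟩
    · exact ⟨1, fun h => absurd h hq⟩
  choose A hA using hrep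
  -- Applied to the real and imaginary parts of cz + d, with m = Im z and R = e^t.
  obtain ⟨hfin, hcard⟩ := ncard_le_of_wedge (s := orbitCosets Γ z t)
    (x := fun q => A q 1 0 * z.re + A q 1 1) (y := fun q => A q 1 0 * z.im)
    z.im_pos (Real.exp_pos t) (fun q hq => normSq_denom_le_of_dist_le (hA q hq).1) (by
      intro p hp q hq hpq
      obtain ⟨-, hpΓ, hpc⟩ := hA p hp
      obtain ⟨-, hqΓ, hqc⟩ := hA q hq
      have h := hΓ.one_le_abs_wedge hpΓ hqΓ (by rwa [hpc, hqc])
      have heq : (A p 1 0 * z.re + A p 1 1) * (A q 1 0 * z.im) -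
          (A q 1 0 * z.re + A q 1 1) * (A p 1 0 * z.im) =
          (A p 1 1 * A q 1 0 - A q 1 1 * A p 1 0) * z.im := by ring
      rw [heq, abs_mul, abs_of_pos z.im_pos]
      exact le_mul_of_one_le_left z.im_pos.le h)
  refine ⟨hfin, hcard.trans ?_⟩
  linarith [Real.one_le_exp ht]
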